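/- Let $n\ge 1$ be an integer and let $\mathbb{B}^n$ be the open unit ball of $\mathbb{C}^n$ with respect to the Euclidean norm. Let $p\in[2,\infty)$ and let $f:\mathbb{B}^n\to\mathbb{C}$ be twice continuously differentiable (in the real sense) with ${\rm Re}\big(f(z)\overline{\Delta f(z)}\big)\ge 0$ for all $z\in\mathbb{B}^n$, where $$\Delta=4\sum_{k=1}^{n}\frac{\partial^2}{\partial z_k\,\partial\overline{z}_k}=\sum_{k=1}^{n}\left(\frac{\partial^2}{\partial x_k^2}+\frac{\partial^2}{\partial y_k^2}\right),\qquad z_k=x_k+iy_k .$$ Then $$\int_{\mathbb{B}^{n}}d(z)\,\Delta\big(|f(z)|^{p}\big)\,dV_{N}(z)<\infty$$ if and only if $f\in\mathcal{H}_g^p(\mathbb{B}^n)$. Here $d(z)$ is the Euclidean distance from $z$ to $\partial\mathbb{B}^n$, and $dV_N$ is the Lebesgue volume measure on $\mathbb{B}^n$ normalized to total mass one. For $0<p<\infty$ the generalized Hardy space $\mathcal{H}_g^p(\mathbb{B}^n)$ consists of all measurable functions $f:\mathbb{B}^n\to\mathbb{C}$ for which $$M_p(r,f)=\left(\int_{\partial\mathbb{B}^n}|f(r\zeta)|^p\,d\sigma(\zeta)\right)^{1/p}$$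 exists for every $r\in(0,1)$ and $\sup_{0<r<1}M_p(r,f)<\infty$, where $d\sigma$ is the surface measure on $\partial\mathbb{B}^n$ normalized to total mass one. -/

import Mathlib

open MeasureTheory Metric Set
open scoped ENNReal ComplexConjugate InnerProductSpace Laplacian

noncomputable section

/-- Complex Euclidean `n`-space. Its real inner product (for which the coordinate vectors in the
directions `x_k`, `y_k` are orthonormal) gives the usual volume and the usual Laplacian
`Δ = ∑ k, (∂²/∂x_k² + ∂²/∂y_k²)`. -/
abbrev CSpace (n : ℕ) : Type := EuclideanSpace ℂ (Fin n)

/-- The open unit ball of `ℂⁿ`. -/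
abbrev unitBall (n : ℕ) : Set (CSpace n) := ball 0 1

/-- The Euclidean distance from `z` to the boundary of the unit ball. -/
def bdryDist {n : ℕ} (z : CSpace n) : ℝ := infDist z (frontier (unitBall n))

/-- The normalized Lebesgue volume measure `dV_N` of the unit ball (total mass one). -/
def normalizedVolume (n : ℕ) : Measure (CSpace n) :=
  (volume (unitBall n))⁻¹ • volume.restrict (unitBall n)

/-- The normalized Lebesgue surface measure `dσ` of the unit sphere (total mass one). -/
def normalizedSurface (n : ℕ) : Measure (sphere (0 : CSpace n) 1) :=
  ((volume : Measure (CSpace n)).toSphere univ)⁻¹ • (volume : Measure (CSpace n)).toSphere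

/-- The integral mean `M_p(r, f) = (∫ |f(r ζ)|^p dσ(ζ))^{1/p}`, for `0 < p < ∞`. -/
def integralMean {n : ℕ} (p r : ℝ) (f : CSpace n → ℂ) : ℝ :=
  (∫ ζ : sphere (0 : CSpace n) 1, ‖f (r • (ζ : CSpace n))‖ ^ p ∂normalizedSurface n) ^ (1 / p)

/-- `M_p(r, f)` exists (as a real number): the integral that defines it converges. -/
def IntegralMeanExists {n : ℕ} (p r : ℝ) (f : CSpace n → ℂ) : Prop :=
  Integrable (fun ζ : sphere (0 : CSpace n) 1 => ‖f (r • (ζ : CSpace n))‖ ^ p)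
    (normalizedSurface n)

open Classical in
/-- `‖f‖_p`, as an extended nonnegative number: `sup_{0<r<1} M_p(r, f)` for `0 < p < ∞`, and
`sup_{z ∈ 𝔹ⁿ} |f(z)|` for `p = ∞`. -/
def hardyNorm {n : ℕ} (p : ℝ≥0∞) (f : CSpace n → ℂ) : ℝ≥0∞ :=
  if p = ∞ then ⨆ z ∈ unitBall n, ‖f z‖ₑ
  else ⨆ r ∈ Ioo (0 : ℝ) 1, ENNReal.ofReal (integralMean p.toReal r f)

/-- The generalized Hardy space `H_g^p(𝔹ⁿ)`, for `0 < p ≤ ∞`: (Lebesgue) measurable functions on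
the unit ball all of whose means `M_p(r, f)`, `0 < r < 1`, exist (if `p < ∞`) and with
`‖f‖_p < ∞`. A function on the ball is represented by a function on `ℂⁿ` whose values
outside of the ball are irrelevant. -/
def generalizedHardySpace (n : ℕ) (p : ℝ≥0∞) : Set (CSpace n → ℂ) :=
  {f | AEMeasurable f (volume.restrict (unitBall n)) ∧
    (p ≠ ∞ → ∀ r ∈ Ioo (0 : ℝ) 1, IntegralMeanExists p.toReal r f) ∧
    hardyNorm p f < ∞}

end

/-! Put `u = |f|^p` and let `N = 2n` be the real dimension. Since `p ≥ 2`, `u` is `C²` and `Δu ≥ p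
|f|^(p-2) Re(f conj(Δf)) ≥ 0` (`laplacian_norm_rpow_nonneg`), so only the subharmonicity of `u`
matters from then on.

Let `m(r)` and `A(r)` be the integrals of `u(rζ)` and `Δu(rζ)` over the unit sphere. They satisfy
`(r^(N-1) m')' = r^(N-1) A` (`hasDerivAt_pow_mul_integral_sphere_fderiv`). This is proved without
the divergence theorem: the second-order operators `∑ J²`, over the generators `J` of rotations,
give `Δ` minus its radial part, and they integrate to zero over spheres by rotation invariance.

As `d(z) = 1 - |z|`, polar coordinates turn the volume integral into that of `(1-r) r^(N-1) A`. With
`G = r^(N-1) m'`, a primitive is `(1-r) G + ∫₀^r G`, and it is bounded exactly when `m` is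
(`integrableOn_Ioo_iff_bddAbove_of_radial_ode`). Boundedness of `m` is the Hardy condition. -/

/-! ### Regularity and subharmonicity of powers of the norm. -/

section NormPow

open Filter Topology Asymptotics

variable {E F : Type*} [NormedAddCommGroup E] [InnerProductSpace ℝ E]
  [NormedAddCommGroup F] [InnerProductSpace ℝ F]

/-- The derivative of `x ↦ ‖x‖ ^ q • x`. -/
noncomputable def normRpowSMulFDeriv (q : ℝ) (x : F) : F →L[ℝ] F :=
  ‖x‖ ^ q • ContinuousLinearMap.id ℝ F + (q * ‖x‖ ^ (q - 2)) • (innerSL ℝ x).smulRight x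

theorem normRpowSMulFDeriv_zero {q : ℝ} (hq : 0 < q) : normRpowSMulFDeriv q (0 : F) = 0 := by
  ext; simp [normRpowSMulFDeriv, Real.zero_rpow hq.ne']

theorem norm_normRpowSMulFDeriv_le {q : ℝ} (hq : 0 < q) (x : F) :
    ‖normRpowSMulFDeriv q x‖ ≤ (1 + q) * ‖x‖ ^ q := by
  rcases eq_or_ne x 0 with rfl | hx
  · rw [normRpowSMulFDeriv_zero hq, norm_zero]; positivity
  have hx' : 0 < ‖x‖ := norm_pos_iff.2 hx
  refine (norm_add_le _ _).trans ?_
  rw [norm_smul, norm_smul, ContinuousLinearMap.norm_smulRight_apply, innerSL_apply_norm,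
    Real.norm_of_nonneg (by positivity), Real.norm_of_nonneg (by positivity), add_mul, one_mul]
  have h : ‖x‖ ^ q = ‖x‖ ^ (q - 2) * (‖x‖ * ‖x‖) := by
    rw [← pow_two, ← Real.rpow_natCast, ← Real.rpow_add hx']; norm_num
  refine add_le_add (mul_le_of_le_one_right (by positivity) ContinuousLinearMap.norm_id_le) ?_
  rw [mul_assoc, h]

theorem hasFDerivAt_norm_rpow_smul {q : ℝ} (hq : 0 ≤ q) (x : F) :
    HasFDerivAt (fun x : F => ‖x‖ ^ q • x) (normRpowSMulFDeriv q x) x := by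
  rcases hq.eq_or_lt with rfl | hq
  · have : normRpowSMulFDeriv 0 x = ContinuousLinearMap.id ℝ F := by
      ext; simp [normRpowSMulFDeriv]
    simp only [this, Real.rpow_zero, one_smul]
    exact hasFDerivAt_id x
  rcases eq_or_ne x 0 with rfl | hx
  · rw [normRpowSMulFDeriv_zero hq]
    refine .of_isLittleO ?_
    have h : Tendsto (fun x : F => ‖x‖ ^ q) (𝓝 0) (𝓝 0) := by
      simpa [Real.zero_rpow hq.ne'] using
        (continuous_norm (E := F)).continuousAt.rpow_const (x := 0) (.inr hq.le) |>.tendsto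
    simpa using ((isLittleO_one_iff ℝ).2 h).smul_isBigO (isBigO_refl (fun x : F => x) (𝓝 0))
  · have h := ((hasStrictFDerivAt_norm_sq x).hasFDerivAt.rpow_const (p := q / 2)
      (.inl (by simp [hx])))
    have h2 : (fun x : F => (‖x‖ ^ 2) ^ (q / 2)) = fun x : F => ‖x‖ ^ q := by
      ext y
      rw [← Real.rpow_natCast, ← Real.rpow_mul (norm_nonneg y)]; congr 1; push_cast; ring
    have h3 : (‖x‖ ^ 2) ^ (q / 2 - 1) = ‖x‖ ^ (q - 2) := by
      rw [← Real.rpow_natCast, ← Real.rpow_mul (norm_nonneg x)]; congr 1; push_cast; ring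
    rw [h2, h3] at h
    convert! h.smul (hasFDerivAt_id x) using 1
    ext v
    simp [normRpowSMulFDeriv, smul_smul]
    congr 1
    ring

theorem continuous_normRpowSMulFDeriv {q : ℝ} (hq : 0 ≤ q) :
    Continuous (normRpowSMulFDeriv q : F → F →L[ℝ] F) := by
  rcases hq.eq_or_lt with rfl | hq
  · have : (normRpowSMulFDeriv 0 : F → F →L[ℝ] F) = fun _ => ContinuousLinearMap.id ℝ F := by
      ext; simp [normRpowSMulFDeriv]
    exact this ▸ continuous_const
  refine continuous_iff_continuousAt.2 fun x => ?_
  rcases eq_or_ne x 0 with rfl | hx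
  · rw [ContinuousAt, normRpowSMulFDeriv_zero hq]
    refine squeeze_zero_norm (norm_normRpowSMulFDeriv_le hq) ?_
    simpa [Real.zero_rpow hq.ne'] using
      ((continuous_norm (E := F)).continuousAt.rpow_const (x := 0) (.inr hq.le)
        |>.const_mul (1 + q)).tendsto
  · have h1 : ContinuousAt (fun x : F => (innerSL ℝ x).smulRight x) x := by
      have := ((ContinuousLinearMap.smulRightL ℝ F F).continuous₂.comp
        ((innerSL ℝ (E := F)).continuous.prodMk continuous_id))
      exact this.continuousAt
    unfold normRpowSMulFDeriv
    have h2 : ContinuousAt (fun x : F => ‖x‖ ^ q) x :=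
      continuous_norm.continuousAt.rpow_const (.inr hq.le)
    have h3 : ContinuousAt (fun x : F => ‖x‖ ^ (q - 2)) x :=
      continuous_norm.continuousAt.rpow_const (.inl (by simp [hx]))
    exact (h2.smul continuousAt_const).add ((continuousAt_const.mul h3).smul h1)

theorem contDiff_norm_rpow_smul {q : ℝ} (hq : 0 ≤ q) :
    ContDiff ℝ 1 (fun x : F => ‖x‖ ^ q • x) := by
  rw [contDiff_one_iff_fderiv]
  refine ⟨fun x => (hasFDerivAt_norm_rpow_smul hq x).differentiableAt, ?_⟩
  rw [funext fun x : F => (hasFDerivAt_norm_rpow_smul hq x).fderiv]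
  exact continuous_normRpowSMulFDeriv hq

/-- The gradient of `‖x‖ ^ p` is `p ‖x‖ ^ (p - 2) x`, which is `C¹` even at the origin because `p -
2 ≥ 0`. -/
theorem contDiff_two_norm_rpow {p : ℝ} (hp : 2 ≤ p) : ContDiff ℝ 2 (fun x : F => ‖x‖ ^ p) := by
  have h1 : 1 < p := by linarith
  rw [← one_add_one_eq_two, contDiff_succ_iff_fderiv]
  refine ⟨differentiable_norm_rpow h1, by simp, ?_⟩
  have : fderiv ℝ (fun x : F => ‖x‖ ^ p) = fun x => p • innerSL ℝ (‖x‖ ^ (p - 2) • x) := by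
    ext x v
    simp [fderiv_norm_rpow x h1, mul_assoc]
  rw [this]
  exact ((innerSL ℝ (E := F)).contDiff.comp
    (contDiff_norm_rpow_smul (sub_nonneg.2 hp))).const_smul p

/-- The form equals `‖x‖^q ‖v‖² + q ‖x‖^(q-2) ⟪x, v⟫²`; this is the convexity of the norm power. -/
theorem inner_normRpowSMulFDeriv_self_nonneg {q : ℝ} (hq : 0 ≤ q) (x v : F) :
    0 ≤ ⟪normRpowSMulFDeriv q x v, v⟫_ℝ := by
  simp only [normRpowSMulFDeriv, add_apply, smul_apply,
    ContinuousLinearMap.id_apply, ContinuousLinearMap.smulRight_apply, innerSL_apply_apply,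
    inner_add_left, real_inner_smul_left, real_inner_self_eq_norm_sq]
  have := mul_self_nonneg ⟪x, v⟫_ℝ
  positivity

/-- Differentiating `p ⟪‖f‖^(p-2) f, Df e⟫` along `e` gives the left side plus the convexity form
evaluated at `Df e`, which is dropped. -/
theorem le_fderiv_fderiv_norm_rpow {p : ℝ} (hp : 2 ≤ p) {f : E → F} {z : E}
    (hf : ContDiffAt ℝ 2 f z) (e : E) :
    p * ‖f z‖ ^ (p - 2) * ⟪f z, fderiv ℝ (fderiv ℝ f) z e e⟫_ℝ ≤
      fderiv ℝ (fderiv ℝ fun w => ‖f w‖ ^ p) z e e := by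
  have h1 : 1 < p := by linarith
  have hfd : ∀ᶠ w in 𝓝 z, fderiv ℝ (fun w => ‖f w‖ ^ p) w e =
      p * ⟪‖f w‖ ^ (p - 2) • f w, fderiv ℝ f w e⟫_ℝ := by
    filter_upwards [hf.eventually (by simp)] with w hw
    have := (hasFDerivAt_norm_rpow (f w) h1).comp w (hw.differentiableAt two_ne_zero).hasFDerivAt
    erw [this.fderiv]
    simp [real_inner_smul_left, mul_assoc]
  have hu : ContDiffAt ℝ 2 (fun w => ‖f w‖ ^ p) z := (contDiff_two_norm_rpow hp).contDiffAt.comp z hf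
  have hu' : DifferentiableAt ℝ (fderiv ℝ fun w => ‖f w‖ ^ p) z :=
    (hu.fderiv_right (m := 1) (by norm_num)).differentiableAt one_ne_zero
  have hf' : DifferentiableAt ℝ (fderiv ℝ f) z :=
    (hf.fderiv_right (m := 1) (by norm_num)).differentiableAt one_ne_zero
  have hV := (hasFDerivAt_norm_rpow_smul (sub_nonneg.2 hp) (f z)).comp z
    (hf.differentiableAt two_ne_zero).hasFDerivAt
  have hD := (hV.inner ℝ (hf'.hasFDerivAt.clm_apply (hasFDerivAt_const e z))).const_mul p
  have hE := (hu'.hasFDerivAt.clm_apply (hasFDerivAt_const e z)).congr_of_eventuallyEq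
    (hfd.mono fun _ h => h.symm)
  have := congrArg (fun L => L e) (hE.unique hD)
  simp only [add_apply, smul_apply,
    ContinuousLinearMap.comp_apply, ContinuousLinearMap.prod_apply, fderivInnerCLM_apply,
    ContinuousLinearMap.flip_apply, zero_apply, map_zero, zero_add,
    Function.comp_apply, real_inner_smul_left, smul_eq_mul] at this
  rw [this]
  have h0 := inner_normRpowSMulFDeriv_self_nonneg (sub_nonneg.2 hp) (f z) (fderiv ℝ f z e)
  nlinarith

theorem laplacian_eq_sum_fderiv {ι : Type*} [Fintype ι] [FiniteDimensional ℝ E]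
    (b : OrthonormalBasis ι ℝ E) (f : E → F) (z : E) :
    Δ f z = ∑ i, fderiv ℝ (fderiv ℝ f) z (b i) (b i) := by
  simp [InnerProductSpace.laplacian_eq_iteratedFDeriv_orthonormalBasis f b, iteratedFDeriv_two_apply]

theorem laplacian_norm_rpow_nonneg [FiniteDimensional ℝ E] {p : ℝ} (hp : 2 ≤ p) {f : E → F} {z : E}
    (hf : ContDiffAt ℝ 2 f z) (h : 0 ≤ ⟪f z, Δ f z⟫_ℝ) : 0 ≤ Δ (fun w => ‖f w‖ ^ p) z := by
  let b := stdOrthonormalBasis ℝ E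
  rw [laplacian_eq_sum_fderiv b]
  refine le_trans ?_ (Finset.sum_le_sum fun i _ => le_fderiv_fderiv_norm_rpow hp hf (b i))
  rw [← Finset.mul_sum, ← inner_sum, ← laplacian_eq_sum_fderiv b]
  positivity

end NormPow

/-! ### Differentiation under integrals over compact spaces. -/

section ParametricIntegral

open Topology

theorem integrable_of_continuous_compactSpace {K : Type*} [TopologicalSpace K] [CompactSpace K]
    [MeasurableSpace K] [OpensMeasurableSpace K] {μ : Measure K} [IsFiniteMeasure μ]
    {g : K → ℝ} (hg : Continuous g) : Integrable g μ :=
  hg.integrable_of_hasCompactSupport (HasCompactSupport.of_compactSpace g)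

theorem hasDerivAt_integral_of_continuousOn {K : Type*} [TopologicalSpace K] [CompactSpace K]
    [MeasurableSpace K] [OpensMeasurableSpace K] {μ : Measure K} [IsFiniteMeasure μ]
    {F F' : ℝ → K → ℝ} {U : Set ℝ} (hU : IsOpen U) {t₀ : ℝ} (ht₀ : t₀ ∈ U)
    (hF : ContinuousOn (fun x : ℝ × K => F x.1 x.2) (U ×ˢ univ))
    (hF' : ContinuousOn (fun x : ℝ × K => F' x.1 x.2) (U ×ˢ univ))
    (hd : ∀ t ∈ U, ∀ k, HasDerivAt (fun s => F s k) (F' t k) t) :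
    HasDerivAt (fun t => ∫ k, F t k ∂μ) (∫ k, F' t₀ k ∂μ) t₀ := by
  have hs {G : ℝ → K → ℝ} (hG : ContinuousOn (fun x : ℝ × K => G x.1 x.2) (U ×ˢ univ)) {t : ℝ}
      (ht : t ∈ U) : Continuous (G t) :=
    hG.comp_continuous (f := fun k => (t, k)) (by fun_prop) (by simp [ht])
  obtain ⟨ε, hε, hεU⟩ := Metric.nhds_basis_closedBall.mem_iff.1 (hU.mem_nhds ht₀)
  obtain ⟨C, hC⟩ := ((isCompact_closedBall t₀ ε).prod (isCompact_univ (X := K)))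
    |>.exists_bound_of_continuousOn (hF'.mono (prod_mono hεU subset_rfl))
  refine (hasDerivAt_integral_of_dominated_loc_of_deriv_le (bound := fun _ => C)
    (closedBall_mem_nhds t₀ hε) ?_ (integrable_of_continuous_compactSpace (hs hF ht₀))
    (integrable_of_continuous_compactSpace (hs hF' ht₀)).aestronglyMeasurable ?_
    (integrable_const C) ?_).2
  · filter_upwards [hU.mem_nhds ht₀] with t ht
    exact (integrable_of_continuous_compactSpace (hs hF ht)).aestronglyMeasurable
  · exact .of_forall fun k t ht => hC (t, k) ⟨ht, mem_univ k⟩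
  · exact .of_forall fun k t ht => hd t (hεU ht) k

end ParametricIntegral

/-! ### Algebra of the generators of rotations. -/

section InfinitesimalRotation

variable {E : Type*} [NormedAddCommGroup E] [InnerProductSpace ℝ E]

/-- Negative radii are admitted so that spherical means live on an open interval around 0 and need
no one-sided analysis there. -/
theorem smul_sphere_mem_ball {r : ℝ} (hr : r ∈ Ioo (-1) 1) (ζ : sphere (0 : E) 1) :
    r • (ζ : E) ∈ ball (0 : E) 1 := by
  simpa [norm_smul, abs_lt] using hr

/-- The infinitesimal rotation in the plane spanned by `a` and `b`. -/
noncomputable def infinitesimalRotation (a b : E) : E →L[ℝ] E :=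
  (innerSL ℝ a).smulRight b - (innerSL ℝ b).smulRight a

theorem infinitesimalRotation_apply (a b x : E) :
    infinitesimalRotation a b x = ⟪a, x⟫_ℝ • b - ⟪b, x⟫_ℝ • a := rfl

theorem infinitesimalRotation_mem_skewAdjoint [FiniteDimensional ℝ E] (a b : E) :
    infinitesimalRotation a b ∈ skewAdjoint (E →L[ℝ] E) := by
  rw [skewAdjoint.mem_iff, ContinuousLinearMap.star_eq_adjoint, eq_comm,
    ContinuousLinearMap.eq_adjoint_iff]
  intro x y
  simp only [neg_apply, infinitesimalRotation_apply, inner_neg_left, inner_sub_left,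
    inner_sub_right, real_inner_smul_left, real_inner_smul_right, real_inner_comm x]
  ring

/-- In coordinates `J z = z_i b_j - z_j b_i`: the two square terms each sum to `‖z‖² tr H`, the two
cross terms each to `-H z z`. -/
theorem sum_bilin_infinitesimalRotation {ι : Type*} [Fintype ι] (b : OrthonormalBasis ι ℝ E)
    (H : E →L[ℝ] E →L[ℝ] ℝ) (z : E) :
    ∑ i, ∑ j, H (infinitesimalRotation (b i) (b j) z) (infinitesimalRotation (b i) (b j) z) =
      2 * (‖z‖ ^ 2 * ∑ i, H (b i) (b i) - H z z) := by
  have hz : H z z = ∑ i, ∑ j, ⟪b i, z⟫_ℝ * ⟪b j, z⟫_ℝ * H (b i) (b j) := by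
    conv_lhs => rw [← b.sum_repr' z]
    simp only [map_sum, map_smul, sum_apply, smul_apply, smul_eq_mul, Finset.mul_sum, mul_assoc]
    rw [Finset.sum_comm]
    exact Finset.sum_congr rfl fun i _ => Finset.sum_congr rfl fun j _ => by ring
  have hz' : H z z = ∑ i, ∑ j, ⟪b i, z⟫_ℝ * ⟪b j, z⟫_ℝ * H (b j) (b i) := by
    rw [hz, Finset.sum_comm]
    exact Finset.sum_congr rfl fun i _ => Finset.sum_congr rfl fun j _ => by ring
  have hn : ‖z‖ ^ 2 * ∑ i, H (b i) (b i) = ∑ i, ∑ j, ⟪b i, z⟫_ℝ ^ 2 * H (b j) (b j) := by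
    rw [← b.sum_sq_inner_right z, Finset.sum_mul_sum]
  have hn' : ‖z‖ ^ 2 * ∑ i, H (b i) (b i) = ∑ i, ∑ j, ⟪b j, z⟫_ℝ ^ 2 * H (b i) (b i) := by
    rw [hn, Finset.sum_comm]
  rw [mul_sub, two_mul, two_mul]
  nth_rw 1 [hn]
  nth_rw 1 [hn']
  nth_rw 1 [hz]
  rw [hz']
  simp only [← Finset.sum_add_distrib, ← Finset.sum_sub_distrib]
  refine Finset.sum_congr rfl fun i _ => Finset.sum_congr rfl fun j _ => ?_
  simp only [infinitesimalRotation_apply, map_sub, map_smul, sub_apply, smul_apply, smul_eq_mul]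
  ring

theorem sum_infinitesimalRotation_sq {ι : Type*} [Fintype ι] (b : OrthonormalBasis ι ℝ E) (z : E) :
    ∑ i, ∑ j, infinitesimalRotation (b i) (b j) (infinitesimalRotation (b i) (b j) z) =
      (2 * (1 - Module.finrank ℝ E) : ℝ) • z := by
  classical
  -- For `i ≠ j` the square of the generator is `-1` on the plane of `b i`, `b j`; the conditional
  -- terms make the diagonal case zero.
  have h (i j : ι) : infinitesimalRotation (b i) (b j) (infinitesimalRotation (b i) (b j) z) =
      (if i = j then ⟪b i, z⟫_ℝ • b j else 0) + (if i = j then ⟪b j, z⟫_ℝ • b i else 0)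
        - ⟪b j, z⟫_ℝ • b j - ⟪b i, z⟫_ℝ • b i := by
    simp only [infinitesimalRotation_apply, inner_sub_right, real_inner_smul_right,
      orthonormal_iff_ite.1 b.orthonormal]
    split_ifs with h1 h2
    · subst h1; simp
    · exact absurd h1.symm h2
    · exact absurd (Eq.symm ‹_›) h1
    · simp [sub_eq_add_neg]
  simp only [h, Finset.sum_sub_distrib, Finset.sum_add_distrib, Finset.sum_ite_eq,
    Finset.mem_univ, if_true, b.sum_repr' z, Finset.sum_const, Finset.card_univ,
    Module.finrank_eq_card_basis b.toBasis]
  simp only [← Finset.smul_sum, b.sum_repr' z]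
  simp only [← Nat.cast_smul_eq_nsmul ℝ]
  module

end InfinitesimalRotation

/-! ### Rotation invariance of the surface measure. -/

section Sphere

open Topology Pointwise

variable {E : Type*} [NormedAddCommGroup E] [InnerProductSpace ℝ E] [FiniteDimensional ℝ E]
  [MeasurableSpace E] [BorelSpace E]

/-- The action of a linear isometry on the unit sphere. -/
def LinearIsometryEquiv.sphereMap (L : E ≃ₗᵢ[ℝ] E) (x : sphere (0 : E) 1) : sphere (0 : E) 1 :=
  ⟨L x, by simp⟩

theorem LinearIsometryEquiv.measurePreserving_sphereMap (L : E ≃ₗᵢ[ℝ] E) :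
    MeasurePreserving L.sphereMap (volume : Measure E).toSphere (volume : Measure E).toSphere := by
  have hm : Measurable L.sphereMap :=
    (Continuous.subtype_mk (L.continuous.comp continuous_subtype_val) _).measurable
  refine ⟨hm, ?_⟩
  ext s hs
  rw [Measure.map_apply hm hs, Measure.toSphere_apply' _ hs, Measure.toSphere_apply' _ (hm hs)]
  congr 1
  -- The surface measure of a set comes from the volume of the cone over it, and isometries carry
  -- cones to cones.
  have : Ioo (0 : ℝ) 1 • (Subtype.val '' (L.sphereMap ⁻¹' s)) =
      L ⁻¹' (Ioo (0 : ℝ) 1 • (Subtype.val '' s)) := by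
    ext x
    simp only [mem_smul, mem_image, mem_preimage]
    constructor
    · rintro ⟨r, hr, _, ⟨y, hy, rfl⟩, rfl⟩
      exact ⟨r, hr, _, ⟨_, hy, rfl⟩, by simp [LinearIsometryEquiv.sphereMap]⟩
    · rintro ⟨r, hr, _, ⟨y, hy, rfl⟩, h⟩
      have hy' : L.sphereMap (L.symm.sphereMap y) = y := by
        ext; simp [LinearIsometryEquiv.sphereMap]
      refine ⟨r, hr, _, ⟨L.symm.sphereMap y, by rwa [hy'], rfl⟩, ?_⟩
      apply L.injective
      simpa [LinearIsometryEquiv.sphereMap] using h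
  rw [this]
  exact L.measurePreserving.measure_preimage_equiv (f := L.toMeasurableEquiv) _

theorem LinearIsometryEquiv.integral_sphere_comp (L : E ≃ₗᵢ[ℝ] E) (g : E → ℝ) :
    ∫ ζ : sphere (0 : E) 1, g (L ζ) ∂(volume : Measure E).toSphere =
      ∫ ζ : sphere (0 : E) 1, g ζ ∂(volume : Measure E).toSphere := by
  have he : MeasurableEmbedding L.sphereMap := by
    have h (M : E ≃ₗᵢ[ℝ] E) : Measurable M.sphereMap := M.measurePreserving_sphereMap.measurable
    exact (MeasurableEquiv.mk ⟨L.sphereMap, L.symm.sphereMap,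
      fun x => by ext; simp [LinearIsometryEquiv.sphereMap],
      fun x => by ext; simp [LinearIsometryEquiv.sphereMap]⟩ (h L) (h L.symm)).measurableEmbedding
  exact L.measurePreserving_sphereMap.integral_comp he (fun ζ => g ζ)

/-- The derivative of a function along the vector field of an infinitesimal rotation has vanishing
integral over every centered sphere. -/
theorem integral_sphere_fderiv_skewAdjoint {v : E → ℝ} (hv : ContDiffOn ℝ 1 v (ball 0 1))
    {J : E →L[ℝ] E} (hJ : J ∈ skewAdjoint (E →L[ℝ] E)) {r : ℝ} (hr : r ∈ Ioo (-1) 1) :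
    ∫ ζ : sphere (0 : E) 1, fderiv ℝ v (r • (ζ : E)) (J (r • (ζ : E)))
      ∂(volume : Measure E).toSphere = 0 := by
  -- Since `exp (t • J)` is orthogonal, the integral of `v (exp (t • J) (r • ζ))` is constant in
  -- `t`; its derivative at `t = 0` is the integral sought.
  have hu (t : ℝ) : NormedSpace.exp (t • J) ∈ unitary (E →L[ℝ] E) :=
    letI := NormedAlgebra.restrictScalars ℚ ℝ (E →L[ℝ] E)
    NormedSpace.exp_mem_unitary_of_mem_skewAdjoint (skewAdjoint.smul_mem t hJ)
  let L (t : ℝ) : E ≃ₗᵢ[ℝ] E := Unitary.linearIsometryEquiv ⟨_, hu t⟩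
  have hL (t : ℝ) (x : E) : NormedSpace.exp (t • J) x = L t x := rfl
  have hmem (t : ℝ) (ζ : sphere (0 : E) 1) :
      NormedSpace.exp (t • J) (r • (ζ : E)) ∈ ball (0 : E) 1 := by
    rw [hL, mem_ball_zero_iff, (L t).norm_map, ← mem_ball_zero_iff]
    exact smul_sphere_mem_ball hr ζ
  have hexp : Continuous fun t : ℝ => NormedSpace.exp (t • J) :=
    (differentiable_exp_smul_const ℝ J).continuous
  have hcurve : Continuous fun x : ℝ × sphere (0 : E) 1 =>
      NormedSpace.exp (x.1 • J) (r • (x.2 : E)) :=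
    (hexp.comp continuous_fst).clm_apply (by fun_prop)
  have hfd : ContinuousOn (fderiv ℝ v) (ball 0 1) :=
    hv.continuousOn_fderiv_of_isOpen isOpen_ball le_rfl
  have key := hasDerivAt_integral_of_continuousOn (μ := (volume : Measure E).toSphere)
    (F := fun t ζ => v (NormedSpace.exp (t • J) (r • (ζ : E))))
    (F' := fun t ζ => fderiv ℝ v (NormedSpace.exp (t • J) (r • (ζ : E)))
      (J (NormedSpace.exp (t • J) (r • (ζ : E))))) isOpen_univ (mem_univ 0)
    (hv.continuousOn.comp hcurve.continuousOn fun x _ => hmem x.1 x.2)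
    ((hfd.comp hcurve.continuousOn fun x _ => hmem x.1 x.2).clm_apply
      (J.continuous.comp hcurve).continuousOn)
    (fun t _ ζ => by
      have h1 : HasDerivAt (fun t : ℝ => NormedSpace.exp (t • J) (r • (ζ : E)))
          (J (NormedSpace.exp (t • J) (r • (ζ : E)))) t := by
        simpa using (hasDerivAt_exp_smul_const' J t).clm_apply
          (hasDerivAt_const t (r • (ζ : E)))
      have h2 : HasFDerivAt v (fderiv ℝ v (NormedSpace.exp (t • J) (r • (ζ : E))))
          (NormedSpace.exp (t • J) (r • (ζ : E))) :=
        ((hv.contDiffAt (isOpen_ball.mem_nhds (hmem t ζ))).differentiableAt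
          one_ne_zero).hasFDerivAt
      exact h2.comp_hasDerivAt t h1)
  have hconst : (fun t : ℝ => ∫ ζ : sphere (0 : E) 1, v (NormedSpace.exp (t • J) (r • (ζ : E)))
      ∂(volume : Measure E).toSphere) = fun _ => ∫ ζ : sphere (0 : E) 1, v (r • (ζ : E))
      ∂(volume : Measure E).toSphere := by
    ext t
    rw [← (L t).integral_sphere_comp fun x => v (r • x)]
    simp [hL]
  rw [hconst] at key
  simpa using key.unique (hasDerivAt_const _ _)

end Sphere

/-! ### The one-dimensional radial problem. -/

section RadialODE

open Topology Filter

theorem monotoneOn_Ico_of_hasDerivAt_nonneg {f f' : ℝ → ℝ} {a b : ℝ}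
    (hc : ContinuousOn f (Ico a b)) (hd : ∀ r ∈ Ioo a b, HasDerivAt f (f' r) r)
    (h0 : ∀ r ∈ Ioo a b, 0 ≤ f' r) : MonotoneOn f (Ico a b) := by
  refine monotoneOn_of_deriv_nonneg (convex_Ico a b) hc ?_ ?_ <;> rw [interior_Ico]
  · exact fun r hr => (hd r hr).differentiableAt.differentiableWithinAt
  · exact fun r hr => (hd r hr).deriv ▸ h0 r hr

/-- A nonnegative continuous function with a primitive on `[0, 1)` is integrable if and only if that
primitive is bounded above. -/
theorem integrableOn_Ioo_iff_bddAbove_primitive {Φ φ : ℝ → ℝ} (hΦ : ContinuousOn Φ (Ico 0 1))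
    (hφ : ContinuousOn φ (Ico 0 1)) (hd : ∀ r ∈ Ioo (0 : ℝ) 1, HasDerivAt Φ (φ r) r)
    (h0 : ∀ r ∈ Ioo (0 : ℝ) 1, 0 ≤ φ r) :
    IntegrableOn φ (Ioo 0 1) ↔ ∃ C, ∀ r ∈ Ioo (0 : ℝ) 1, Φ r ≤ C := by
  have hii {R : ℝ} (hR : R ∈ Ioo (0 : ℝ) 1) : IntervalIntegrable φ volume 0 R :=
    (hφ.mono (by rw [uIcc_of_le hR.1.le]; exact Icc_subset_Ico_right hR.2)).intervalIntegrable
  have hftc {R : ℝ} (hR : R ∈ Ioo (0 : ℝ) 1) : ∫ r in Ioc 0 R, φ r = Φ R - Φ 0 := by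
    rw [← intervalIntegral.integral_of_le hR.1.le]
    exact intervalIntegral.integral_eq_sub_of_hasDerivAt_of_le hR.1.le
      (hΦ.mono (Icc_subset_Ico_right hR.2))
      (fun r hr => hd r ⟨hr.1, hr.2.trans hR.2⟩) (hii hR)
  constructor
  · intro hi
    refine ⟨Φ 0 + ∫ r in Ioo 0 1, φ r, fun R hR => ?_⟩
    have : ∫ r in Ioc 0 R, φ r ≤ ∫ r in Ioo 0 1, φ r :=
      setIntegral_mono_set hi ((ae_restrict_mem measurableSet_Ioo).mono h0)
        (LE.le.eventuallyLE fun r hr => ⟨hr.1, hr.2.trans_lt hR.2⟩)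
    linarith [hftc hR]
  · rintro ⟨C, hC⟩
    -- An exhaustion of the interval; the shift by 2 keeps `b 0 = 1/2` positive.
    let b (i : ℕ) : ℝ := 1 - 1 / ((i : ℝ) + 2)
    have hb (i : ℕ) : b i ∈ Ioo (0 : ℝ) 1 := by
      have : (0 : ℝ) < (i : ℝ) + 2 := by positivity
      have h1 : 1 / ((i : ℝ) + 2) < 1 := by
        rw [div_lt_one this]; linarith [Nat.cast_nonneg (α := ℝ) i]
      exact ⟨by simp only [b]; linarith, by simp only [b]; linarith [one_div_pos.2 this]⟩
    have hb1 : Tendsto b atTop (𝓝 1) := by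
      have := ((tendsto_add_atTop_iff_nat 1).2 (tendsto_one_div_add_atTop_nhds_zero_nat (𝕜 := ℝ)))
        |>.const_sub 1
      refine (by simpa using this : Tendsto _ _ _).congr fun i => ?_
      simp only [b]; ring
    refine (integrableOn_Ioc_of_intervalIntegral_norm_bounded_right (I := C - Φ 0)
      (fun i => (intervalIntegrable_iff_integrableOn_Ioc_of_le (hb i).1.le).1 (hii (hb i))) hb1
      (.of_forall fun i => ?_)).mono_set Ioo_subset_Ioc_self
    rw [setIntegral_congr_fun (g := φ) measurableSet_Ioc fun r hr =>
      Real.norm_of_nonneg (h0 r ⟨hr.1, hr.2.trans_lt (hb i).2⟩), hftc (hb i)]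
    linarith [hC _ (hb i)]

/-- If `(r ^ k * m') ' = r ^ k * A` with `A ≥ 0`, then `m` is bounded if and only if
`(1 - r) * r ^ k * A` is integrable. -/
theorem integrableOn_Ioo_iff_bddAbove_of_radial_ode {k : ℕ} (hk : k ≠ 0) {m m' A : ℝ → ℝ}
    (hm : ∀ r ∈ Ioo (-1 : ℝ) 1, HasDerivAt m (m' r) r) (hm' : ContinuousOn m' (Ioo (-1) 1))
    (hG : ∀ r ∈ Ioo (0 : ℝ) 1, HasDerivAt (fun r => r ^ k * m' r) (r ^ k * A r) r)
    (hA : ContinuousOn A (Ioo (-1) 1)) (hA0 : ∀ r ∈ Ioo (0 : ℝ) 1, 0 ≤ A r) :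
    IntegrableOn (fun r => (1 - r) * (r ^ k * A r)) (Ioo 0 1) ↔
      ∃ C, ∀ r ∈ Ioo (0 : ℝ) 1, m r ≤ C := by
  have hsub : Ico (0 : ℝ) 1 ⊆ Ioo (-1) 1 := fun r hr => ⟨by linarith [hr.1], hr.2⟩
  have hsub' : Ioo (0 : ℝ) 1 ⊆ Ioo (-1) 1 := Ioo_subset_Ico_self.trans hsub
  set G : ℝ → ℝ := fun r => r ^ k * m' r with hGdef
  have hGc : ContinuousOn G (Ioo (-1) 1) := (continuous_pow k).continuousOn.mul hm'
  have hGmono : MonotoneOn G (Ico 0 1) := monotoneOn_Ico_of_hasDerivAt_nonneg (hGc.mono hsub) hG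
    fun r hr => mul_nonneg (pow_nonneg hr.1.le k) (hA0 r hr)
  -- `G` is increasing, and `G 0 = 0` because `k ≠ 0`.
  have hG0 {r : ℝ} (hr : r ∈ Ico (0 : ℝ) 1) : 0 ≤ G r := by
    simpa [hGdef, hk] using hGmono (left_mem_Ico.2 one_pos) hr hr.1
  let P (r : ℝ) : ℝ := ∫ x in (0 : ℝ)..r, G x
  have hP0 : P 0 = 0 := intervalIntegral.integral_same
  have hP {r : ℝ} (hr : r ∈ Ioo (-1 : ℝ) 1) : HasDerivAt P (G r) r := by
    refine intervalIntegral.integral_hasDerivAt_right ?_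
      (hGc.stronglyMeasurableAtFilter isOpen_Ioo r hr) (hGc.continuousAt (isOpen_Ioo.mem_nhds hr))
    exact (hGc.mono (ordConnected_Ioo.uIcc_subset (by norm_num) hr)).intervalIntegrable
  have hPc : ContinuousOn P (Ico 0 1) := fun r hr => (hP (hsub hr)).continuousAt.continuousWithinAt
  have hPmono : MonotoneOn P (Ico 0 1) := monotoneOn_Ico_of_hasDerivAt_nonneg hPc
    (fun r hr => hP (hsub' hr)) fun r hr => hG0 (Ioo_subset_Ico_self hr)
  have hPnonneg {r : ℝ} (hr : r ∈ Ico (0 : ℝ) 1) : 0 ≤ P r :=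
    hP0 ▸ hPmono (left_mem_Ico.2 one_pos) hr hr.1
  have hmc : ContinuousOn m (Ico 0 1) := fun r hr => (hm r (hsub hr)).continuousAt.continuousWithinAt
  have hm0 {r : ℝ} (hr : r ∈ Ioo (0 : ℝ) 1) : 0 ≤ m' r :=
    nonneg_of_mul_nonneg_right (hG0 (Ioo_subset_Ico_self hr)) (pow_pos hr.1 k)
  have hmmono : MonotoneOn m (Ico 0 1) := monotoneOn_Ico_of_hasDerivAt_nonneg hmc
    (fun r hr => hm r (hsub' hr)) fun r hr => hm0 hr
  -- Integration by parts: the term `-G` from differentiating `1 - r` cancels against `P' = G`.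
  rw [integrableOn_Ioo_iff_bddAbove_primitive (Φ := fun r => (1 - r) * G r + P r)
    (φ := fun r => (1 - r) * (r ^ k * A r))
    (((continuous_const.sub continuous_id).continuousOn.mul (hGc.mono hsub)).add hPc)
    ((continuous_const.sub continuous_id).continuousOn.mul
      ((continuous_pow k).continuousOn.mul (hA.mono hsub)))
    (fun r hr => by
      convert! (((hasDerivAt_id r).const_sub 1).mul (hG r hr)).add (hP (hsub' hr)) using 1
      simp)
    (fun r hr => mul_nonneg (by linarith [hr.2]) (mul_nonneg (pow_nonneg hr.1.le k) (hA0 r hr)))]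
  constructor
  · rintro ⟨C, hC⟩
    -- On `[1/2, 1)` one has `(2r)^k ≥ 1`, so `m' ≤ 2^k G`; below `1/2`, monotonicity of `m`
    -- suffices.
    have hlow : MonotoneOn (fun r => 2 ^ k * P r - m r) (Ico (1 / 2) 1) := by
      have hs : Ico (1 / 2 : ℝ) 1 ⊆ Ico 0 1 := Ico_subset_Ico_left (by norm_num)
      refine monotoneOn_Ico_of_hasDerivAt_nonneg
        ((continuousOn_const.mul (hPc.mono hs)).sub (hmc.mono hs))
        (f' := fun r => 2 ^ k * G r - m' r) (fun r hr => ?_) fun r hr => ?_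
      · have hr' : r ∈ Ioo (-1 : ℝ) 1 := ⟨by linarith [hr.1], hr.2⟩
        exact ((hP hr').const_mul _).sub (hm r hr')
      · have hr' : r ∈ Ioo (0 : ℝ) 1 := ⟨by linarith [hr.1], hr.2⟩
        have h1 : 1 ≤ (2 * r) ^ k := one_le_pow₀ (by linarith [hr.1])
        have h2 : 2 ^ k * G r = (2 * r) ^ k * m' r := by simp only [hGdef, mul_pow]; ring
        nlinarith [hm0 hr']
    refine ⟨m (1 / 2) + 2 ^ k * C, fun r hr => ?_⟩
    have hPC : P r ≤ C := by
      have := hC r hr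
      nlinarith [hG0 (Ioo_subset_Ico_self hr), hr.2]
    have hC0 := (hPnonneg (Ioo_subset_Ico_self hr)).trans hPC
    have h2k : (0 : ℝ) < 2 ^ k := by positivity
    rcases le_total r (1 / 2) with h | h
    · have := hmmono (Ioo_subset_Ico_self hr) (by norm_num : (1 / 2 : ℝ) ∈ Ico (0 : ℝ) 1) h
      nlinarith
    · have := hlow (by norm_num : (1 / 2 : ℝ) ∈ Ico (1 / 2 : ℝ) 1) ⟨h, hr.2⟩ h
      simp only at this
      nlinarith [hPnonneg (by norm_num : (1 / 2 : ℝ) ∈ Ico (0 : ℝ) 1)]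
  · rintro ⟨C, hC⟩
    have hup : MonotoneOn (fun r => m r - P r) (Ico 0 1) := by
      refine monotoneOn_Ico_of_hasDerivAt_nonneg (hmc.sub hPc) (f' := fun r => m' r - G r)
        (fun r hr => (hm r (hsub' hr)).sub (hP (hsub' hr))) fun r hr => ?_
      have : r ^ k ≤ 1 := pow_le_one₀ hr.1.le hr.2.le
      simp only [hGdef]
      nlinarith [hm0 hr]
    have hPC {r : ℝ} (hr : r ∈ Ioo (0 : ℝ) 1) : P r ≤ C - m 0 := by
      have := hup (left_mem_Ico.2 one_pos) (Ioo_subset_Ico_self hr) hr.1.le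
      simp only [hP0] at this
      linarith [hC r hr]
    -- As `G` is increasing, `G r * (1 - r) / 2` is at most the integral of `G` over `[r, (1 + r) /
    -- 2]`, hence at most `C - m 0`. So `(1 - r) * G r` costs twice `C - m 0` and `P r` once.
    refine ⟨3 * (C - m 0), fun r hr => ?_⟩
    have hmid : (1 + r) / 2 ∈ Ioo (0 : ℝ) 1 := ⟨by linarith [hr.1], by linarith [hr.2]⟩
    have hs : Ico r 1 ⊆ Ico (0 : ℝ) 1 := Ico_subset_Ico_left hr.1.le
    have hlin : MonotoneOn (fun x => P x - G r * x) (Ico r 1) := by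
      refine monotoneOn_Ico_of_hasDerivAt_nonneg
        ((hPc.mono hs).sub (continuous_const.mul continuous_id).continuousOn)
        (f' := fun x => G x - G r * 1) (fun x hx => ?_) fun x hx => ?_
      · exact (hP (hsub (hs (Ioo_subset_Ico_self hx)))).sub ((hasDerivAt_id x).const_mul _)
      · linarith [hGmono (Ioo_subset_Ico_self hr) (hs (Ioo_subset_Ico_self hx)) hx.1.le]
    have h1 := hlin ⟨le_rfl, hr.2⟩ ⟨by linarith [hr.2], hmid.2⟩
      (by linarith [hr.2] : r ≤ (1 + r) / 2)
    simp only at h1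
    nlinarith [hPC hmid, hPC hr, hPnonneg (Ioo_subset_Ico_self hr)]

end RadialODE

/-! ### Functions on the ball restricted to rays and spheres. -/

section SmulSphere

variable {E : Type*} [NormedAddCommGroup E] [InnerProductSpace ℝ E]

theorem continuousOn_comp_smul_sphere {X : Type*} [TopologicalSpace X] {g : E → X}
    (hg : ContinuousOn g (ball 0 1)) :
    ContinuousOn (fun x : ℝ × sphere (0 : E) 1 => g (x.1 • (x.2 : E))) (Ioo (-1) 1 ×ˢ univ) :=
  hg.comp (by fun_prop) fun x hx => smul_sphere_mem_ball hx.1 x.2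

theorem continuous_comp_smul_sphere {X : Type*} [TopologicalSpace X] {g : E → X}
    (hg : ContinuousOn g (ball 0 1)) {r : ℝ} (hr : r ∈ Ioo (-1) 1) :
    Continuous fun ζ : sphere (0 : E) 1 => g (r • (ζ : E)) :=
  hg.comp_continuous (by fun_prop) (smul_sphere_mem_ball hr)

theorem hasDerivAt_comp_smul {F : Type*} [NormedAddCommGroup F] [NormedSpace ℝ F] {g : E → F}
    (hg : ContDiffOn ℝ 1 g (ball 0 1)) {r : ℝ} (hr : r ∈ Ioo (-1) 1) (ζ : sphere (0 : E) 1) :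
    HasDerivAt (fun s => g (s • (ζ : E))) (fderiv ℝ g (r • (ζ : E)) ζ) r := by
  have h1 : HasDerivAt (fun s : ℝ => s • (ζ : E)) ζ r := by
    simpa only [one_smul] using (hasDerivAt_id' r).smul_const (ζ : E)
  exact ((hg.contDiffAt (isOpen_ball.mem_nhds (smul_sphere_mem_ball hr ζ))).differentiableAt
    one_ne_zero).hasFDerivAt.comp_hasDerivAt r h1

theorem ContDiffOn.fderiv_ball_two {F : Type*} [NormedAddCommGroup F] [NormedSpace ℝ F] {u : E → F}
    (hu : ContDiffOn ℝ 2 u (ball 0 1)) : ContDiffOn ℝ 1 (fderiv ℝ u) (ball 0 1) :=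
  hu.fderiv_of_isOpen isOpen_ball (by norm_num)

theorem continuousOn_laplacian [FiniteDimensional ℝ E] {u : E → ℝ} (hu : ContDiffOn ℝ 2 u (ball 0 1)) :
    ContinuousOn (Δ u) (ball 0 1) := by
  rw [funext (laplacian_eq_sum_fderiv (stdOrthonormalBasis ℝ E) u)]
  have := hu.fderiv_ball_two.continuousOn_fderiv_of_isOpen isOpen_ball le_rfl
  exact continuousOn_finsetSum _ fun i _ =>
    (this.clm_apply continuousOn_const).clm_apply continuousOn_const

end SmulSphere

/-! ### The differential equation for spherical means. -/

section SphereODE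

variable {E : Type*} [NormedAddCommGroup E] [InnerProductSpace ℝ E] [FiniteDimensional ℝ E]
  [MeasurableSpace E] [BorelSpace E]

theorem hasDerivAt_integral_sphere {u : E → ℝ} (hu : ContDiffOn ℝ 1 u (ball 0 1)) {r : ℝ}
    (hr : r ∈ Ioo (-1) 1) :
    HasDerivAt (fun r => ∫ ζ : sphere (0 : E) 1, u (r • (ζ : E)) ∂(volume : Measure E).toSphere)
      (∫ ζ : sphere (0 : E) 1, fderiv ℝ u (r • (ζ : E)) ζ ∂(volume : Measure E).toSphere) r := by
  refine hasDerivAt_integral_of_continuousOn (F := fun r (ζ : sphere (0 : E) 1) => u (r • (ζ : E)))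
    (F' := fun r (ζ : sphere (0 : E) 1) => fderiv ℝ u (r • (ζ : E)) ζ) isOpen_Ioo hr
    (continuousOn_comp_smul_sphere hu.continuousOn)
    ((continuousOn_comp_smul_sphere (hu.continuousOn_fderiv_of_isOpen isOpen_ball le_rfl)).clm_apply
      (by fun_prop)) fun t ht ζ => hasDerivAt_comp_smul hu ht ζ

theorem hasDerivAt_integral_sphere_fderiv {u : E → ℝ} (hu : ContDiffOn ℝ 2 u (ball 0 1)) {r : ℝ}
    (hr : r ∈ Ioo (-1) 1) :
    HasDerivAt (fun r => ∫ ζ : sphere (0 : E) 1, fderiv ℝ u (r • (ζ : E)) ζ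
        ∂(volume : Measure E).toSphere)
      (∫ ζ : sphere (0 : E) 1, fderiv ℝ (fderiv ℝ u) (r • (ζ : E)) ζ ζ
        ∂(volume : Measure E).toSphere) r := by
  have hu' := hu.fderiv_ball_two
  refine hasDerivAt_integral_of_continuousOn
    (F := fun r (ζ : sphere (0 : E) 1) => fderiv ℝ u (r • (ζ : E)) ζ)
    (F' := fun r (ζ : sphere (0 : E) 1) => fderiv ℝ (fderiv ℝ u) (r • (ζ : E)) ζ ζ) isOpen_Ioo hr
    ((continuousOn_comp_smul_sphere hu'.continuousOn).clm_apply (by fun_prop))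
    (((continuousOn_comp_smul_sphere (hu'.continuousOn_fderiv_of_isOpen isOpen_ball
      le_rfl)).clm_apply (by fun_prop)).clm_apply (by fun_prop)) fun t ht ζ => ?_
  simpa only [map_zero, add_zero] using (hasDerivAt_comp_smul hu' ht ζ).clm_apply
    (hasDerivAt_const t (ζ : E))

/-- The mean over a sphere of the Laplacian, in polar coordinates. -/
theorem sq_mul_integral_sphere_laplacian {u : E → ℝ} (hu : ContDiffOn ℝ 2 u (ball 0 1)) {r : ℝ}
    (hr : r ∈ Ioo (-1) 1) :
    r ^ 2 * ∫ ζ : sphere (0 : E) 1, Δ u (r • (ζ : E)) ∂(volume : Measure E).toSphere =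
      r ^ 2 * (∫ ζ : sphere (0 : E) 1, fderiv ℝ (fderiv ℝ u) (r • (ζ : E)) ζ ζ
        ∂(volume : Measure E).toSphere) +
      (Module.finrank ℝ E - 1) * (r * ∫ ζ : sphere (0 : E) 1, fderiv ℝ u (r • (ζ : E)) ζ
        ∂(volume : Measure E).toSphere) := by
  let b := stdOrthonormalBasis ℝ E
  have hu' := hu.fderiv_ball_two
  have hu'c := hu'.continuousOn
  have hu'' := hu'.continuousOn_fderiv_of_isOpen isOpen_ball le_rfl
  let J (i j) : E →L[ℝ] E := infinitesimalRotation (b i) (b j)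
  have hv (i j) : ContDiffOn ℝ 1 (fun z => fderiv ℝ u z (J i j z)) (ball 0 1) :=
    hu'.clm_apply (J i j).contDiff.contDiffOn
  have hvd (i j) {z : E} (hz : z ∈ ball (0 : E) 1) :
      fderiv ℝ (fun z => fderiv ℝ u z (J i j z)) z (J i j z) =
        fderiv ℝ (fderiv ℝ u) z (J i j z) (J i j z) + fderiv ℝ u z (J i j (J i j z)) := by
    have h2 := ((hu'.contDiffAt (isOpen_ball.mem_nhds hz)).differentiableAt
      one_ne_zero).hasFDerivAt
    rw [(h2.clm_apply (J i j).hasFDerivAt).fderiv]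
    simp [add_comm]
  -- The invariance lemma is applied to the first rotational derivative of `u`, so second rotational
  -- derivatives have zero mean.
  have hsum : ∑ i, ∑ j, ∫ ζ : sphere (0 : E) 1, fderiv ℝ (fun z => fderiv ℝ u z (J i j z))
      (r • (ζ : E)) (J i j (r • (ζ : E))) ∂(volume : Measure E).toSphere = 0 :=
    Finset.sum_eq_zero fun i _ => Finset.sum_eq_zero fun j _ =>
      integral_sphere_fderiv_skewAdjoint (hv i j) (infinitesimalRotation_mem_skewAdjoint _ _) hr
  have hint (i j) : Integrable (fun ζ : sphere (0 : E) 1 =>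
      fderiv ℝ (fun z => fderiv ℝ u z (J i j z)) (r • (ζ : E)) (J i j (r • (ζ : E))))
      (volume : Measure E).toSphere :=
    integrable_of_continuous_compactSpace
      ((continuous_comp_smul_sphere ((hv i j).continuousOn_fderiv_of_isOpen isOpen_ball le_rfl) hr).clm_apply (by fun_prop))
  simp_rw [← integral_finsetSum _ fun j _ => hint _ j] at hsum
  rw [← integral_finsetSum _ fun i _ => integrable_finsetSum _ fun j _ => hint i j] at hsum
  -- Pointwise, `∑ J²` is `2 (r² Δ - r² ∂_r² - (N - 1) r ∂_r)`.
  have hpt (ζ : sphere (0 : E) 1) :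
      ∑ i, ∑ j, fderiv ℝ (fun z => fderiv ℝ u z (J i j z)) (r • (ζ : E)) (J i j (r • (ζ : E))) =
        2 * (r ^ 2 * Δ u (r • (ζ : E)) - r ^ 2 * fderiv ℝ (fderiv ℝ u) (r • (ζ : E)) ζ ζ -
          (Module.finrank ℝ E - 1) * (r * fderiv ℝ u (r • (ζ : E)) ζ)) := by
    simp_rw [hvd _ _ (smul_sphere_mem_ball hr ζ), Finset.sum_add_distrib]
    rw [sum_bilin_infinitesimalRotation, ← laplacian_eq_sum_fderiv b]
    simp_rw [← map_sum]
    rw [sum_infinitesimalRotation_sq]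
    simp [norm_smul]
    ring
  simp_rw [hpt] at hsum
  have i1 : Integrable (fun ζ : sphere (0 : E) 1 => r ^ 2 * Δ u (r • (ζ : E)))
      (volume : Measure E).toSphere :=
    (integrable_of_continuous_compactSpace (continuous_comp_smul_sphere (continuousOn_laplacian hu) hr)).const_mul _
  have i2 : Integrable (fun ζ : sphere (0 : E) 1 =>
      r ^ 2 * fderiv ℝ (fderiv ℝ u) (r • (ζ : E)) ζ ζ) (volume : Measure E).toSphere :=
    (integrable_of_continuous_compactSpace
      (((continuous_comp_smul_sphere hu'' hr).clm_apply (by fun_prop)).clm_apply (by fun_prop))).const_mul _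
  have i3 : Integrable (fun ζ : sphere (0 : E) 1 =>
      (Module.finrank ℝ E - 1 : ℝ) * (r * fderiv ℝ u (r • (ζ : E)) ζ))
      (volume : Measure E).toSphere :=
    ((integrable_of_continuous_compactSpace
      ((continuous_comp_smul_sphere hu'c hr).clm_apply (by fun_prop))).const_mul _).const_mul _
  have i12 : Integrable (fun ζ : sphere (0 : E) 1 => r ^ 2 * Δ u (r • (ζ : E)) -
      r ^ 2 * fderiv ℝ (fderiv ℝ u) (r • (ζ : E)) ζ ζ) (volume : Measure E).toSphere := i1.sub i2
  rw [integral_const_mul, integral_sub i12 i3, integral_sub i1 i2] at hsum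
  simp only [integral_const_mul] at hsum
  linarith

theorem hasDerivAt_pow_mul_integral_sphere_fderiv (hE : 2 ≤ Module.finrank ℝ E) {u : E → ℝ}
    (hu : ContDiffOn ℝ 2 u (ball 0 1)) {r : ℝ} (hr : r ∈ Ioo (0 : ℝ) 1) :
    HasDerivAt (fun r => r ^ (Module.finrank ℝ E - 1) *
        ∫ ζ : sphere (0 : E) 1, fderiv ℝ u (r • (ζ : E)) ζ ∂(volume : Measure E).toSphere)
      (r ^ (Module.finrank ℝ E - 1) *
        ∫ ζ : sphere (0 : E) 1, Δ u (r • (ζ : E)) ∂(volume : Measure E).toSphere) r := by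
  have hr' : r ∈ Ioo (-1 : ℝ) 1 := ⟨by linarith [hr.1], hr.2⟩
  have h := sq_mul_integral_sphere_laplacian hu hr'
  -- Writing the dimension as `k + 2` removes truncated subtraction; `r` times the goal is then `r ^
  -- k` times `h`.
  obtain ⟨k, hk⟩ := Nat.exists_eq_add_of_le' hE
  convert! (hasDerivAt_pow (Module.finrank ℝ E - 1) r).mul
    (hasDerivAt_integral_sphere_fderiv hu hr') using 1
  rw [hk] at h ⊢
  simp only [Nat.add_one_sub_one, show k + 2 - 1 = k + 1 from rfl, pow_succ] at h ⊢
  push_cast at h ⊢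
  have hr0 := hr.1.ne'
  apply mul_left_cancel₀ hr0
  linear_combination r ^ k * h

end SphereODE

/-! ### Polar coordinates. -/

section Polar

variable {E : Type*} [NormedAddCommGroup E] [InnerProductSpace ℝ E] [FiniteDimensional ℝ E]
  [MeasurableSpace E] [BorelSpace E]

theorem integrable_volumeIoiPow_iff (k : ℕ) (φ : ℝ → ℝ) :
    Integrable (fun r : Ioi (0 : ℝ) => φ r) (Measure.volumeIoiPow k) ↔
      IntegrableOn (fun r => r ^ k * φ r) (Ioi 0) := by
  rw [Measure.volumeIoiPow, integrable_withDensity_iff_integrable_smul' (by fun_prop) (by simp),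
    integrableOn_iff_comap_subtypeVal measurableSet_Ioi]
  refine integrable_congr (.of_forall ?_)
  rintro ⟨x, hx : 0 < x⟩
  simp (disch := positivity) [ENNReal.toReal_ofReal]

theorem integrable_iff_polar [Nontrivial E] (h : E → ℝ) :
    Integrable h ↔ Integrable (fun x : sphere (0 : E) 1 × Ioi (0 : ℝ) => h ((x.2 : ℝ) • (x.1 : E)))
      ((volume : Measure E).toSphere.prod (Measure.volumeIoiPow (Module.finrank ℝ E - 1))) := by
  have hp := (volume : Measure E).measurePreserving_homeomorphUnitSphereProd.integrable_comp_emb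
    (Homeomorph.measurableEmbedding _)
    (g := fun x : sphere (0 : E) 1 × Ioi (0 : ℝ) => h ((x.2 : ℝ) • (x.1 : E)))
  rw [← hp]
  conv_lhs => rw [← restrict_compl_singleton (μ := volume) (0 : E)]
  change IntegrableOn h _ _ ↔ _
  rw [integrableOn_iff_comap_subtypeVal (measurableSet_singleton 0).compl]
  refine integrable_congr (.of_forall fun x => ?_)
  have hx : ‖(x : E)‖ ≠ 0 := norm_ne_zero_iff.2 x.2
  simp [smul_smul, hx]

/-- By nonnegativity the norm of the integrand is the integrand itself, so Fubini reduces
integrability to that of the spherical integrals. -/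
theorem integrableOn_ball_radial_mul_iff [Nontrivial E] {w : ℝ → ℝ} (hw : Continuous w)
    (hw0 : ∀ r ∈ Ioo (0 : ℝ) 1, 0 ≤ w r) {g : E → ℝ}
    (hg : ContinuousOn g (ball 0 1)) (hg0 : ∀ z ∈ ball (0 : E) 1, 0 ≤ g z) :
    IntegrableOn (fun z => w ‖z‖ * g z) (ball 0 1) ↔
      IntegrableOn (fun r => w r * (r ^ (Module.finrank ℝ E - 1) *
        ∫ ζ : sphere (0 : E) 1, g (r • (ζ : E)) ∂(volume : Measure E).toSphere)) (Ioo 0 1) := by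
  set k := Module.finrank ℝ E - 1
  set h : E → ℝ := (ball (0 : E) 1).indicator fun z => w ‖z‖ * g z with hh
  have hmeas : AEStronglyMeasurable h := by
    rw [aestronglyMeasurable_indicator_iff measurableSet_ball]
    exact ((hw.comp continuous_norm).continuousOn.mul hg).aestronglyMeasurable measurableSet_ball
  have hval {r : ℝ} (hr : 0 < r) (ζ : sphere (0 : E) 1) :
      h (r • (ζ : E)) = (Iio (1 : ℝ)).indicator (fun r => w r * g (r • (ζ : E))) r := by
    simp [hh, indicator, norm_smul, abs_of_pos hr]
  have hmeas' : AEStronglyMeasurable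
      (fun x : sphere (0 : E) 1 × Ioi (0 : ℝ) => h ((x.2 : ℝ) • (x.1 : E)))
      ((volume : Measure E).toSphere.prod (Measure.volumeIoiPow k)) := by
    have hp := (volume : Measure E).measurePreserving_homeomorphUnitSphereProd
    rw [← hp.aestronglyMeasurable_comp_iff (Homeomorph.measurableEmbedding _)]
    have : AEStronglyMeasurable (fun x : ({0}ᶜ : Set E) => h x)
        ((volume : Measure E).comap Subtype.val) := by
      have h0 := hmeas.restrict (s := ({0}ᶜ : Set E))
      rw [← map_comap_subtype_coe (measurableSet_singleton (0 : E)).compl] at h0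
      exact h0.comp_measurable measurable_subtype_coe
    refine this.congr (.of_forall fun x => ?_)
    have hx : ‖(x : E)‖ ≠ 0 := norm_ne_zero_iff.2 x.2
    simp [smul_smul, hx]
  rw [← integrable_indicator_iff measurableSet_ball, integrable_iff_polar,
    integrable_prod_iff' hmeas']
  have h1 : ∀ r : Ioi (0 : ℝ), Integrable (fun ζ : sphere (0 : E) 1 => h ((r : ℝ) • (ζ : E)))
      (volume : Measure E).toSphere := by
    rintro ⟨r, hr : 0 < r⟩
    simp only [hval hr]
    by_cases hr1 : r < 1
    · simp only [indicator_of_mem (mem_Iio.2 hr1)]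
      exact (integrable_of_continuous_compactSpace
        (continuous_comp_smul_sphere hg ⟨by linarith, hr1⟩)).const_mul _
    · simp [hr1]
  have h2 (r : Ioi (0 : ℝ)) : ∫ ζ : sphere (0 : E) 1, ‖h ((r : ℝ) • (ζ : E))‖
      ∂(volume : Measure E).toSphere = (Iio (1 : ℝ)).indicator
        (fun r => w r * ∫ ζ : sphere (0 : E) 1, g (r • (ζ : E)) ∂(volume : Measure E).toSphere)
        (r : ℝ) := by
    obtain ⟨r, hr : 0 < r⟩ := r
    simp only [hval hr]
    by_cases hr1 : r < 1
    · simp only [indicator_of_mem (mem_Iio.2 hr1), ← integral_const_mul]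
      refine integral_congr_ae (.of_forall fun ζ => Real.norm_of_nonneg ?_)
      exact mul_nonneg (hw0 r ⟨hr, hr1⟩) (hg0 _ (smul_sphere_mem_ball ⟨by linarith, hr1⟩ ζ))
    · simp [hr1]
  simp only [h2]
  rw [and_iff_right (.of_forall h1), integrable_volumeIoiPow_iff, ← integrable_indicator_iff
    measurableSet_Ioi, ← integrable_indicator_iff measurableSet_Ioo]
  refine integrable_congr (.of_forall fun r => ?_)
  by_cases h0 : 0 < r <;> by_cases h1 : r < 1 <;> simp [indicator, h0, h1]
  ring

/-- A `C²` subharmonic function on the unit ball has bounded spherical means if and only if its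
Laplacian is integrable against the distance to the boundary. -/
theorem integrableOn_ball_laplacian_iff (hE : 2 ≤ Module.finrank ℝ E) {u : E → ℝ}
    (hu : ContDiffOn ℝ 2 u (ball 0 1)) (hΔ : ∀ z ∈ ball (0 : E) 1, 0 ≤ Δ u z) :
    IntegrableOn (fun z => (1 - ‖z‖) * Δ u z) (ball 0 1) ↔ ∃ C, ∀ r ∈ Ioo (0 : ℝ) 1,
      ∫ ζ : sphere (0 : E) 1, u (r • (ζ : E)) ∂(volume : Measure E).toSphere ≤ C := by
  have : Nontrivial E := Module.nontrivial_of_finrank_pos (R := ℝ) (by lia)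
  rw [integrableOn_ball_radial_mul_iff (w := fun r => 1 - r) (by fun_prop)
    (fun r hr => by linarith [hr.2]) (continuousOn_laplacian hu) hΔ]
  have hsub {r : ℝ} (hr : r ∈ Ioo (0 : ℝ) 1) : r ∈ Ioo (-1 : ℝ) 1 := ⟨by linarith [hr.1], hr.2⟩
  refine integrableOn_Ioo_iff_bddAbove_of_radial_ode (by lia)
    (fun r hr => hasDerivAt_integral_sphere (hu.of_le one_le_two) hr)
    (fun r hr => (hasDerivAt_integral_sphere_fderiv hu hr).continuousAt.continuousWithinAt)
    (fun r hr => hasDerivAt_pow_mul_integral_sphere_fderiv hE hu hr) ?_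
    fun r hr => integral_nonneg fun ζ => hΔ _ (smul_sphere_mem_ball (hsub hr) ζ)
  -- What remains is continuity of the mean of `Δ u`. Since `Δ u` is only continuous, this is by
  -- domination on compact ranges of radii.
  refine fun r hr => ContinuousAt.continuousWithinAt ?_
  have hc := continuousOn_comp_smul_sphere (continuousOn_laplacian hu)
  obtain ⟨ε, hε, hεU⟩ := Metric.nhds_basis_closedBall.mem_iff.1 (isOpen_Ioo.mem_nhds hr)
  obtain ⟨C, hC⟩ := ((isCompact_closedBall r ε).prod (isCompact_univ (X := sphere (0 : E) 1)))
    |>.exists_bound_of_continuousOn (hc.mono (prod_mono hεU subset_rfl))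
  refine continuousAt_of_dominated (bound := fun _ => C) ?_ ?_ (integrable_const C) ?_
  · filter_upwards [isOpen_Ioo.mem_nhds hr] with t ht
    exact (integrable_of_continuous_compactSpace
      (continuous_comp_smul_sphere (continuousOn_laplacian hu) ht)).aestronglyMeasurable
  · filter_upwards [closedBall_mem_nhds r hε] with t ht
    exact .of_forall fun ζ => hC (t, ζ) ⟨ht, mem_univ ζ⟩
  · refine .of_forall fun ζ => ?_
    exact ((continuousOn_laplacian hu).continuousAt
      (isOpen_ball.mem_nhds (smul_sphere_mem_ball hr ζ))).comp (f := fun t : ℝ => t • (ζ : E))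
      (by fun_prop)

end Polar

/-! ### The ball, the Hardy space and the conclusion. -/

section HardySpace

theorem bdryDist_eq {n : ℕ} [Nontrivial (CSpace n)] {z : CSpace n} (hz : z ∈ unitBall n) :
    bdryDist z = 1 - ‖z‖ := by
  have hz' : ‖z‖ < 1 := by simpa using hz
  rw [bdryDist, unitBall, frontier_ball _ one_ne_zero]
  have hne : (sphere (0 : CSpace n) 1).Nonempty := NormedSpace.sphere_nonempty.2 zero_le_one
  refine le_antisymm ?_ ((le_infDist hne).2 fun y hy => ?_)
  · obtain ⟨ζ, hζ, hzζ⟩ : ∃ ζ ∈ sphere (0 : CSpace n) 1, z = ‖z‖ • ζ := by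
      rcases eq_or_ne z 0 with rfl | h0
      · exact ⟨hne.some, hne.some_mem, by simp⟩
      · exact ⟨‖z‖⁻¹ • z, by simp [norm_smul, h0], by simp [smul_smul, h0]⟩
    refine (infDist_le_dist_of_mem hζ).trans ?_
    have h : z - ζ = (‖z‖ - 1) • ζ := by rw [sub_smul, one_smul, ← hzζ]
    rw [dist_eq_norm, h, norm_smul, mem_sphere_zero_iff_norm.1 hζ, Real.norm_eq_abs,
      abs_of_nonpos (by linarith)]
    linarith
  · have := norm_sub_norm_le y z
    rw [mem_sphere_zero_iff_norm.1 hy] at this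
    rwa [dist_comm, dist_eq_norm]

theorem integrableOn_normalizedVolume_iff {n : ℕ} {g : CSpace n → ℝ} :
    IntegrableOn g (unitBall n) (normalizedVolume n) ↔ IntegrableOn g (unitBall n) := by
  rw [normalizedVolume, IntegrableOn, Measure.restrict_smul,
    Measure.restrict_restrict measurableSet_ball, inter_self, integrable_smul_measure, IntegrableOn]
  · exact ENNReal.inv_ne_zero.2 measure_ball_lt_top.ne
  · exact ENNReal.inv_ne_top.2 (measure_ball_pos _ _ one_pos).ne'

/-- Continuity supplies measurability and the existence of every mean; normalization and the `p`-th
root do not affect boundedness. -/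
theorem mem_generalizedHardySpace_iff {n : ℕ} [Nontrivial (CSpace n)] {p : ℝ} (hp : 0 < p)
    {f : CSpace n → ℂ} (hf : ContinuousOn f (unitBall n)) :
    f ∈ generalizedHardySpace n (ENNReal.ofReal p) ↔ ∃ C, ∀ r ∈ Ioo (0 : ℝ) 1,
      ∫ ζ : sphere (0 : CSpace n) 1, ‖f (r • (ζ : CSpace n))‖ ^ p
        ∂(volume : Measure (CSpace n)).toSphere ≤ C := by
  set c := (volume : Measure (CSpace n)).toSphere univ with hc
  have hc0 : c ≠ 0 := Measure.measure_univ_ne_zero.2 (Measure.toSphere_ne_zero _)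
  have hct : c ≠ ∞ := measure_ne_top _ _
  have hcr : 0 < c.toReal := ENNReal.toReal_pos hc0 hct
  let I (r : ℝ) : ℝ := ∫ ζ : sphere (0 : CSpace n) 1, ‖f (r • (ζ : CSpace n))‖ ^ p
    ∂(volume : Measure (CSpace n)).toSphere
  have hI (r : ℝ) : 0 ≤ I r := integral_nonneg fun ζ => by positivity
  have hmean (r : ℝ) : integralMean p r f = (c.toReal⁻¹ * I r) ^ (1 / p) := by
    rw [integralMean, normalizedSurface, integral_smul_measure, ENNReal.toReal_inv, smul_eq_mul]
  have hex : ∀ r ∈ Ioo (0 : ℝ) 1, IntegralMeanExists p r f := fun r hr => by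
    rw [IntegralMeanExists, normalizedSurface]
    refine (integrable_of_continuous_compactSpace ?_).smul_measure (ENNReal.inv_ne_top.2 hc0)
    exact (continuous_comp_smul_sphere hf ⟨by linarith [hr.1], hr.2⟩).norm.rpow_const
      fun _ => .inr hp.le
  have hmeas : AEMeasurable f (volume.restrict (unitBall n)) := hf.aemeasurable measurableSet_ball
  simp only [generalizedHardySpace, mem_ofPred_eq, ENNReal.toReal_ofReal hp.le, hmeas, true_and,
    hardyNorm, ENNReal.ofReal_ne_top, if_false]
  rw [and_iff_right fun _ => hex]
  constructor
  · intro h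
    lift (⨆ r ∈ Ioo (0 : ℝ) 1, ENNReal.ofReal (integralMean p r f)) to NNReal using h.ne with M hM
    refine ⟨c.toReal * (M : ℝ) ^ p, fun r hr => ?_⟩
    have h1 : ENNReal.ofReal (integralMean p r f) ≤ M :=
      hM ▸ le_iSup₂ (f := fun r (_ : r ∈ Ioo (0 : ℝ) 1) => ENNReal.ofReal (integralMean p r f)) r hr
    rw [ENNReal.ofReal_le_iff_le_toReal ENNReal.coe_ne_top, ENNReal.coe_toReal, hmean] at h1
    have h0 : 0 ≤ c.toReal⁻¹ * I r := mul_nonneg (by positivity) (hI r)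
    have h2 := Real.rpow_le_rpow (by positivity) h1 hp.le
    rw [← Real.rpow_mul h0, one_div_mul_cancel hp.ne', Real.rpow_one, inv_mul_le_iff₀ hcr] at h2
    exact h2
  · rintro ⟨C, hC⟩
    refine lt_of_le_of_lt (iSup₂_le fun r hr => ENNReal.ofReal_le_ofReal (?_ :
      integralMean p r f ≤ (c.toReal⁻¹ * C) ^ (1 / p))) ENNReal.ofReal_lt_top
    rw [hmean]
    have h0 : 0 ≤ c.toReal⁻¹ * I r := mul_nonneg (by positivity) (hI r)
    have : I r ≤ C := hC r hr
    gcongr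

theorem finrank_real_cspace (n : ℕ) : Module.finrank ℝ (CSpace n) = 2 * n := by
  rw [finrank_real_of_complex, finrank_euclideanSpace_fin]

end HardySpace

theorem mainTheorem1 (n : ℕ) (hn : 1 ≤ n) (p : ℝ) (hp : 2 ≤ p) (f : CSpace n → ℂ)
    (hf : ContDiffOn ℝ 2 f (unitBall n))
    (hΔ : ∀ z ∈ unitBall n, 0 ≤ (f z * conj (Δ f z)).re) :
    IntegrableOn (fun z => bdryDist z * Δ (fun w => ‖f w‖ ^ p) z) (unitBall n)
        (normalizedVolume n) ↔
      f ∈ generalizedHardySpace n (ENNReal.ofReal p) := by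
  have hfin : 2 ≤ Module.finrank ℝ (CSpace n) := by rw [finrank_real_cspace]; lia
  have : Nontrivial (CSpace n) := Module.nontrivial_of_finrank_pos (R := ℝ) (two_pos.trans_le hfin)
  have hu : ContDiffOn ℝ 2 (fun w => ‖f w‖ ^ p) (unitBall n) :=
    (contDiff_two_norm_rpow hp).comp_contDiffOn hf
  have hu0 : ∀ z ∈ unitBall n, 0 ≤ Δ (fun w => ‖f w‖ ^ p) z := fun z hz => by
    refine laplacian_norm_rpow_nonneg hp (hf.contDiffAt (isOpen_ball.mem_nhds hz)) ?_
    -- The real inner product on `ℂ` is the real part of one factor times the conjugate of the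
    -- other.
    rw [real_inner_comm, Complex.inner]
    exact mul_comm (f z) _ ▸ hΔ z hz
  rw [integrableOn_normalizedVolume_iff,
    mem_generalizedHardySpace_iff (by linarith) hf.continuousOn,
    ← integrableOn_ball_laplacian_iff hfin hu hu0]
  exact integrableOn_congr_fun (fun z hz => by simp only [bdryDist_eq hz]) measurableSet_ball
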